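/- A *rooted digraph* is a finite loopless digraph $D$ (without parallel arcs) with a distinguished vertex $r$ such that $r$ has indegree $0$ and outdegree at least $2$, and no arc $(x,y)$ with $x\neq r$ ends in an outneighbour $y$ of $r$. Write $N^-(x)$ for the set of in-neighbours of $x$. A set $S\subseteq V(D)\setminus\{r\}$ *cuts* a vertex $z\notin S$ from $r$ if there is no directed path from $r$ to $z$ in $D-S$; a *cutvertex* is a vertex $x \ne r$ such that $\{x\}$ cuts some vertex $z \neq x$ from $r$. A *bipath of length $l-1$* ($l\ge 3$) consists of distinct vertices $x_1,\dots,x_l$ such that the arcs of $D$ incident with $\{x_2,\dots,x_{l-1}\}$ are exactly $(x_i,x_{i+1})$ and $(x_{i+1},x_i)$ for $1\le i\le l-1$. The rooted digraph $D$ is *reduced* if none of the following four reduction rules can be applied to it, that is, if none of the following situations occurs: (0) some vertex of $D$ is not reachable from $r$ (the rule answers FALSE); (1) $D$ has a cutvertex $x$ (the rule deletes $x$ and adds the arcs $(v,z)$ for $v\in N^-(x)$ and $z \ne v$ an outneighbour of $x$); (2) $D$ has a bipath of length $4$ (the rule contracts two consecutive internal vertices of it); (3) there are a vertex $x$ and some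 $y\in N^-(x)$ such that $N^-(x)\setminus\{y\}$ cuts $y$ from $r$ (the rule deletes the arc $(y,x)$). **Theorem.** Let $k\ge 0$ be an integer and let $D$ be a reduced rooted digraph with at least $(3k-2)(30k-2)$ vertices. Then $D$ has an outbranching (a spanning directed tree of $D$ rooted at $r$) with at least $k$ leaves (vertices of outdegree $0$ in the tree). -/

import Mathlib

/-- A rooted digraph on the vertex set `V`: a loopless digraph (without parallel arcs) with a
distinguished vertex `root` of indegree 0 and outdegree at least 2, such that the only arc entering
an outneighbour of `root` is the one coming from `root`. -/
structure RootedDigraph (V : Type*) extends Digraph V where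
  /-- the distinguished vertex -/
  root : V
  loopless : ∀ v, ¬ Adj v v
  no_arc_to_root : ∀ u, ¬ Adj u root
  eq_root_of_adj : ∀ x y, Adj root y → Adj x y → x = root
  two_le_outdegree_root : ∃ a b, a ≠ b ∧ Adj root a ∧ Adj root b

namespace RootedDigraph

variable {V : Type*} (D : RootedDigraph V)

/-- The in-neighbourhood `N⁻(x)`. -/
def inNbrs (x : V) : Set V := {y | D.Adj y x}

/-- There is a directed path (possibly of length zero) from the root to `z` in `D - S`, the digraph
obtained from `D` by deleting the vertices of `S`. -/
def ReachableAvoiding (S : Set V) (z : V) : Prop :=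
  D.root ∉ S ∧ z ∉ S ∧
    Relation.ReflTransGen (fun u v => D.Adj u v ∧ u ∉ S ∧ v ∉ S) D.root z

/-- The set `S ⊆ V - r` cuts the vertex `z ∉ S` from the root `r`: no directed path of `D - S` goes
from `r` to `z`. -/
def CutsFromRoot (S : Set V) (z : V) : Prop :=
  D.root ∉ S ∧ z ∉ S ∧ ¬ D.ReachableAvoiding S z

/-- `S ⊆ V - r` is a cut if it cuts some vertex outside of `S` from the root. -/
def IsCut (S : Set V) : Prop := ∃ z, D.CutsFromRoot S z

/-- A cutvertex is a cut of size one. -/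
def IsCutvertex (x : V) : Prop := D.IsCut {x}

/-- The distinct vertices `x 0, …, x l` form a bipath of length `l ≥ 2`: the arcs of `D` that are
incident with an internal vertex (`x 1, …, x (l - 1)`) are exactly the arcs
`(x i, x (i + 1))` and `(x (i + 1), x i)` for `i < l`. -/
def IsBipath {l : ℕ} (x : Fin (l + 1) → V) : Prop :=
  2 ≤ l ∧ Function.Injective x ∧
    ∀ u v : V,
      (D.Adj u v ∧ ∃ i : Fin (l + 1), 0 < i.val ∧ i.val < l ∧ (u = x i ∨ v = x i)) ↔
        ∃ i : Fin l, (u = x i.castSucc ∧ v = x i.succ) ∨ (u = x i.succ ∧ v = x i.castSucc)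

/-- Rule (0) applies: some vertex is not reachable from the root. -/
def Rule0Applies : Prop := ∃ v, ¬ Relation.ReflTransGen D.Adj D.root v

/-- Rule (1) applies: there is a cutvertex. -/
def Rule1Applies : Prop := ∃ x, D.IsCutvertex x

/-- Rule (2) applies: there is a bipath of length 4. -/
def Rule2Applies : Prop := ∃ x : Fin (4 + 1) → V, D.IsBipath x

/-- Rule (3) applies: there are a vertex `x` and `y ∈ N⁻(x)` such that `N⁻(x) - y` cuts `y` from
the root. -/
def Rule3Applies : Prop := ∃ x, ∃ y ∈ D.inNbrs x, D.CutsFromRoot (D.inNbrs x \ {y}) y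

/-- `D` is reduced: none of the rules (0)–(3) can be applied to it. -/
def IsReduced : Prop :=
  ¬ D.Rule0Applies ∧ ¬ D.Rule1Applies ∧ ¬ D.Rule2Applies ∧ ¬ D.Rule3Applies

/-- `T` is an outbranching of `D`, that is, a spanning directed tree of `D` rooted at the root of
`D`: a subdigraph on all vertices in which the root has no in-neighbour, every other vertex has
exactly one in-neighbour, and every vertex is reachable from the root. -/
structure IsOutbranching (T : Digraph V) : Prop where
  subgraph : T ≤ D.toDigraph
  no_arc_to_root : ∀ u, ¬ T.Adj u D.root
  existsUnique_father : ∀ v, v ≠ D.root → ∃! u, T.Adj u v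
  reachable : ∀ v, Relation.ReflTransGen T.Adj D.root v

/-- The leaves of an outbranching: the vertices of outdegree 0. -/
def leaves (T : Digraph V) : Set V := {v | ∀ w, ¬ T.Adj v w}

end RootedDigraph

/-! Suppose that every outbranching has at most `j = k - 1` leaves. The number of vertices is
bounded by counting the special ones (see `IsSpecial`) and showing that every other vertex lies near
a special one.

The basic tool is `exists_outbranching_of_acyclic`: in an acyclic spanning subdigraph, vertices with
two in-neighbours leave enough freedom in the choice of fathers to make a third of them, roughly,
pay for a leaf. Acyclic subdigraphs come from a directed analogue of st-numberings. As there is no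
cutvertex, the vertices other than `r` can be ordered so that each one not dominated by `r` has
in-neighbours both before and after it; the order is found by solving discrete Dirichlet problems.
Of three in-neighbours two lie on the same side, which bounds the vertices of indegree at least
three.

For arcs outside 2-cycles, choose an increasing and a decreasing outbranching. An arc is transverse
to a tree if it is not a tree arc and does not lead to an ancestor. It is then forward in the
left-to-right or the right-to-left preorder, so transverse arcs with distinct heads are few. An
increasing arc outside 2-cycles is transverse to the decreasing tree or forces a decreasing arc
transverse to the increasing tree. Together these give at most `30 * j + 1` special vertices.

As Rule (3) does not apply, indegrees are at most `j`. The other vertices have indegree two and lie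
on bidirected paths, which are short because there is no bipath of length 4. -/

/-! ### Father functions and small hitting sets. -/

/-- The digraph with the arcs `(f v, v)` for `v ≠ r`. -/
def fatherDigraph {V : Type*} (f : V → V) (r : V) : Digraph V := ⟨fun u v => v ≠ r ∧ f v = u⟩

/-- Greedy choice: an element of `B` hitting two elements of `A` lowers `A.card + B.card` by at
least three at the cost of one. When there is none, the elements of `A` have disjoint sets of at
least two partners, so `2 * A.card ≤ B.card` and one partner for each is affordable. -/
theorem Finset.exists_hitting_card_le {ι β : Type*} [DecidableEq ι] [DecidableEq β]
    (R : ι → β → Prop) (A : Finset ι) :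
    ∀ B : Finset β, (∀ a ∈ A, ∃ b ∈ B, ∃ b' ∈ B, b ≠ b' ∧ R a b ∧ R a b') →
      ∃ X ⊆ B, (∀ a ∈ A, ∃ x ∈ X, R a x) ∧ 3 * X.card ≤ A.card + B.card := by
  classical
  induction A using Finset.strongInduction with
  | H A ih =>
    intro B h
    by_cases hb : ∃ b ∈ B, ∃ a ∈ A, ∃ a' ∈ A, a ≠ a' ∧ R a b ∧ R a' b
    · obtain ⟨b, hbB, a, ha, a', ha', hne, hR, hR'⟩ := hb
      have hss : A.filter (fun x => ¬ R x b) ⊆ A := Finset.filter_subset _ _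
      have hssub : A.filter (fun x => ¬ R x b) ⊂ A :=
        Finset.filter_ssubset.2 ⟨a, ha, by simpa using hR⟩
      obtain ⟨X, hXB, hX, hcard⟩ := ih _ hssub (B.erase b) (by
        intro x hx
        obtain ⟨hxA, hxb⟩ := Finset.mem_filter.1 hx
        obtain ⟨c, hc, c', hc', hcc, h1, h2⟩ := h x hxA
        refine ⟨c, Finset.mem_erase.2 ⟨?_, hc⟩, c', Finset.mem_erase.2 ⟨?_, hc'⟩, hcc, h1, h2⟩
        · rintro rfl; exact hxb h1
        · rintro rfl; exact hxb h2)
      refine ⟨insert b X, ?_, ?_, ?_⟩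
      · exact Finset.insert_subset hbB (hXB.trans (Finset.erase_subset _ _))
      · intro x hx
        by_cases hxb : R x b
        · exact ⟨b, Finset.mem_insert_self _ _, hxb⟩
        · obtain ⟨y, hy, hxy⟩ := hX x (Finset.mem_filter.2 ⟨hx, hxb⟩)
          exact ⟨y, Finset.mem_insert_of_mem hy, hxy⟩
      · have h1 := Finset.card_insert_le b X
        have h2 := Finset.card_erase_of_mem hbB
        have h3 : 0 < B.card := Finset.card_pos.2 ⟨b, hbB⟩
        have h4 : ({a, a'} : Finset ι) ⊆ A.filter (fun x => R x b) := by
          intro x hx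
          simp only [Finset.mem_insert, Finset.mem_singleton] at hx
          rcases hx with rfl | rfl <;> simp [*]
        have h5 := Finset.card_le_card h4
        rw [Finset.card_pair hne] at h5
        have h6 := Finset.card_filter_add_card_filter_not (s := A) (fun x => R x b)
        omega
    · have hb' : ∀ b ∈ B, ∀ a ∈ A, ∀ a' ∈ A, R a b → R a' b → a = a' := by
        intro b hbB a ha a' ha' h1 h2
        by_contra hne
        exact hb ⟨b, hbB, a, ha, a', ha', hne, h1, h2⟩
      rcases isEmpty_or_nonempty β with hβ | hβ
      · exact ⟨∅, Finset.empty_subset _, fun a ha => hβ.elim (h a ha).choose, by simp⟩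
      choose! c hc c' hc' hcc h1 h2 using h
      refine ⟨A.image c, ?_, ?_, ?_⟩
      · intro x hx
        obtain ⟨a, ha, rfl⟩ := Finset.mem_image.1 hx
        exact hc a ha
      · intro a ha
        exact ⟨c a, Finset.mem_image_of_mem c ha, h1 a ha⟩
      · have hi : Set.InjOn c A := fun a ha a' ha' hE =>
          hb' (c a) (hc a ha) a ha a' ha' (h1 a ha) (hE ▸ h1 a' ha')
        have hi' : Set.InjOn c' A := fun a ha a' ha' hE =>
          hb' (c' a) (hc' a ha) a ha a' ha' (h2 a ha) (hE ▸ h2 a' ha')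
        have hd : Disjoint (A.image c) (A.image c') := by
          rw [Finset.disjoint_left]
          intro x hx hx'
          obtain ⟨a, ha, rfl⟩ := Finset.mem_image.1 hx
          obtain ⟨a', ha', hE⟩ := Finset.mem_image.1 hx'
          have : a = a' := hb' (c a) (hc a ha) a ha a' ha' (h1 a ha) (hE ▸ h2 a' ha')
          subst this
          exact hcc a ha hE.symm
        have hsub : A.image c ∪ A.image c' ⊆ B := by
          intro x hx
          rcases Finset.mem_union.1 hx with hx | hx <;>
            obtain ⟨a, ha, rfl⟩ := Finset.mem_image.1 hx
          · exact hc a ha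
          · exact hc' a ha
        have := Finset.card_le_card hsub
        rw [Finset.card_union_of_disjoint hd, Finset.card_image_of_injOn hi,
          Finset.card_image_of_injOn hi'] at this
        rw [Finset.card_image_of_injOn hi]
        omega

/-! ### Constructing outbranchings with many leaves. -/

namespace RootedDigraph

variable {V : Type*} (D : RootedDigraph V)

theorem isOutbranching_fatherDigraph [Finite V] {α : Type*} [Preorder α] {f : V → V} (ρ : V → α)
    (hf : ∀ v, v ≠ D.root → D.Adj (f v) v) (hρ : ∀ v, v ≠ D.root → ρ (f v) < ρ v) :
    D.IsOutbranching (fatherDigraph f D.root) where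
  subgraph := by
    rintro u v ⟨hv, rfl⟩
    exact hf v hv
  no_arc_to_root := fun u h => h.1 rfl
  existsUnique_father := fun v hv => ⟨f v, ⟨hv, rfl⟩, fun _ hu => hu.2.symm⟩
  reachable := by
    have wf : WellFounded (fun u v : V => ρ u < ρ v) :=
      haveI : IsTrans V (fun u v : V => ρ u < ρ v) := ⟨fun _ _ _ => lt_trans⟩
      haveI : Std.Irrefl (fun u v : V => ρ u < ρ v) := ⟨fun _ => lt_irrefl _⟩
      Finite.wellFounded_of_trans_of_irrefl _
    intro v
    induction v using wf.induction with
    | _ v ih =>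
      by_cases hv : v = D.root
      · rw [hv]
      · exact (ih _ (hρ v hv)).tail ⟨hv, rfl⟩

/-- An acyclic spanning subdigraph in which many vertices have two in-neighbours yields an
outbranching with many leaves. -/
theorem exists_outbranching_of_acyclic [Fintype V] [DecidableEq V] {α : Type*} [Preorder α]
    (ρ : V → α) (E : V → V → Prop) (hE : ∀ u v, E u v → D.Adj u v) (hρ : ∀ u v, E u v → ρ u < ρ v)
    (hfather : ∀ v, v ≠ D.root → ∃ u, E u v) (P O : Finset V)
    (hP : ∀ v ∈ P, ∃ u u', u ≠ u' ∧ E u v ∧ E u' v) (hO : ∀ v ∈ O, D.Adj D.root v) :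
    ∃ T, D.IsOutbranching T ∧ P.card + 2 * O.card ≤ 3 * (leaves T).ncard := by
  classical
  have hrP : D.root ∉ P := fun h => by
    obtain ⟨u, _, _, hu, _⟩ := hP _ h
    exact D.no_arc_to_root u (hE _ _ hu)
  have hOP : ∀ v ∈ O, v ∉ P := fun v hv h => by
    obtain ⟨u, u', hne, hu, hu'⟩ := hP _ h
    exact hne ((D.eq_root_of_adj _ _ (hO v hv) (hE _ _ hu)).trans
      (D.eq_root_of_adj _ _ (hO v hv) (hE _ _ hu')).symm)
  choose! g hg using hfather
  set U : Finset V := (insert D.root P)ᶜ with hU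
  have hUne : ∀ v ∈ U, v ≠ D.root := fun v hv => by
    rintro rfl
    simp [hU] at hv
  have hOU : O ⊆ U := fun v hv => by
    have : v ≠ D.root := fun h => D.no_arc_to_root _ (h ▸ hO v hv)
    simp [hU, this, hOP v hv]
  set Z := U.image g with hZ
  -- The vertices of `O` all have the root as father, so together they add at most one element to
  -- `Z`.
  have hZcard : Z.card + O.card ≤ U.card + 1 := by
    have : Z ⊆ insert D.root ((U \ O).image g) := by
      intro x hx
      obtain ⟨v, hv, rfl⟩ := Finset.mem_image.1 hx
      by_cases hvO : v ∈ O
      · rw [D.eq_root_of_adj _ _ (hO v hvO) (hE _ _ (hg v (hUne v hv)))]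
        exact Finset.mem_insert_self _ _
      · exact Finset.mem_insert_of_mem (Finset.mem_image_of_mem _ (Finset.mem_sdiff.2 ⟨hv, hvO⟩))
    have h1 := (Finset.card_le_card this).trans (Finset.card_insert_le _ _)
    have h2 : ((U \ O).image g).card ≤ (U \ O).card := Finset.card_image_le
    have h3 := Finset.card_sdiff_add_card_eq_card hOU
    omega
  -- `Z` consists of fathers that are used anyway. The vertices of `P` it does not dominate still
  -- have two possible fathers outside `Z`, and the hitting set `X` serves them cheaply. Everything
  -- outside `Z ∪ X` becomes a leaf.
  set A := P.filter (fun v => ∀ z ∈ Z, ¬ E z v) with hA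
  obtain ⟨X, -, hX, hXcard⟩ := Finset.exists_hitting_card_le (fun v u => E u v) A Zᶜ (by
    intro v hv
    obtain ⟨hvP, hvZ⟩ := Finset.mem_filter.1 hv
    obtain ⟨u, u', hne, hu, hu'⟩ := hP v hvP
    exact ⟨u, Finset.mem_compl.2 fun h => hvZ u h hu, u', Finset.mem_compl.2 fun h => hvZ u' h hu',
      hne, hu, hu'⟩)
  have hdom : ∀ v, v ≠ D.root → ∃ u ∈ Z ∪ X, E u v := by
    intro v hv
    by_cases hvP : v ∈ P
    · by_cases hvA : v ∈ A
      · obtain ⟨x, hx, hxv⟩ := hX v hvA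
        exact ⟨x, Finset.mem_union_right _ hx, hxv⟩
      · have : ∃ z ∈ Z, E z v := by
          by_contra! hc
          exact hvA (Finset.mem_filter.2 ⟨hvP, hc⟩)
        obtain ⟨z, hz, hzv⟩ := this
        exact ⟨z, Finset.mem_union_left _ hz, hzv⟩
    · refine ⟨g v, Finset.mem_union_left _ (Finset.mem_image_of_mem _ ?_), hg v hv⟩
      simp [hU, hv, hvP]
  choose! f hfZ hf using hdom
  refine ⟨_, D.isOutbranching_fatherDigraph ρ (fun v hv => hE _ _ (hf v hv))
    (fun v hv => hρ _ _ (hf v hv)), ?_⟩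
  have hle : (Z ∪ X)ᶜ.card ≤ (leaves (fatherDigraph f D.root)).ncard := by
    rw [← Set.ncard_coe_finset]
    refine Set.ncard_le_ncard ?_ (Set.toFinite _)
    intro v hv w hw
    have hv' : v ∉ Z ∪ X := by simpa using hv
    exact hv' (hw.2 ▸ hfZ w hw.1)
  have h1 := Finset.card_compl_add_card (Z ∪ X)
  have h2 := Finset.card_union_le Z X
  have h3 := Finset.card_compl_add_card Z
  have h4 : A.card ≤ P.card := Finset.card_filter_le _ _
  have h5 := Finset.card_compl_add_card (insert D.root P)
  rw [← hU, Finset.card_insert_of_notMem hrP] at h5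
  omega

/-- A spanning subdigraph in which every vertex is reachable from the root contains an
outbranching. -/
theorem exists_outbranching_of_reachable [Finite V] (E : V → V → Prop)
    (hE : ∀ u v, E u v → D.Adj u v) (hreach : ∀ v, Relation.ReflTransGen E D.root v) :
    ∃ T, D.IsOutbranching T ∧ ∀ u v, T.Adj u v → E u v := by
  classical
  have key : ∀ v, ∃ n : ℕ, ∃ p : ℕ → V, p 0 = D.root ∧ p n = v ∧ ∀ i < n, E (p i) (p (i + 1)) := by
    intro v
    induction hreach v with
    | refl => exact ⟨0, fun _ => D.root, rfl, rfl, by simp⟩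
    | @tail b c _ hbc ih =>
      obtain ⟨n, p, h0, hn, hp⟩ := ih
      refine ⟨n + 1, fun i => if i ≤ n then p i else c, by simp [h0], by simp, ?_⟩
      intro i hi
      rcases Nat.lt_succ_iff_lt_or_eq.1 hi with hi | rfl
      · have h1 : i ≤ n := hi.le
        have h2 : i + 1 ≤ n := hi
        simpa [h1, h2] using hp i hi
      · simpa [hn] using hbc
  -- `Nat.find (key v)` is the distance from the root; the fathers form a breadth-first tree.
  have hstep : ∀ v, v ≠ D.root → ∃ u, E u v ∧ Nat.find (key u) < Nat.find (key v) := by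
    intro v hv
    obtain ⟨p, h0, hn, hp⟩ := Nat.find_spec (key v)
    rcases hm : Nat.find (key v) with _ | m
    · rw [hm] at hn
      exact absurd (hn.symm.trans h0) hv
    · rw [hm] at hn hp
      refine ⟨p m, hn ▸ hp m (Nat.lt_succ_self m), Nat.lt_succ_of_le (Nat.find_min' _ ?_)⟩
      exact ⟨p, h0, rfl, fun i hi => hp i (hi.trans (Nat.lt_succ_self m))⟩
  choose! f hf hlt using hstep
  refine ⟨_, D.isOutbranching_fatherDigraph (fun v => Nat.find (key v))
    (fun v hv => hE _ _ (hf v hv)) hlt, ?_⟩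
  rintro u v ⟨hv, rfl⟩
  exact hf v hv

variable {D}

theorem IsOutbranching.exists_leaf_descendant [Finite V] {T : Digraph V} (hT : D.IsOutbranching T)
    (v : V) : ∃ l ∈ leaves T, Relation.ReflTransGen T.Adj v l := by
  have hirr : ∀ v, ¬ Relation.TransGen T.Adj v v := by
    -- A closed walk through a vertex also passes through its unique father, hence is pushed back to
    -- the root, which nothing enters.
    have key : ∀ v, Relation.ReflTransGen T.Adj D.root v → ¬ Relation.TransGen T.Adj v v := by
      intro v hv
      induction hv with
      | refl =>
        intro h
        obtain ⟨u, -, hu⟩ := Relation.TransGen.tail'_iff.1 h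
        exact hT.no_arc_to_root u hu
      | @tail b c _ hbc ih =>
        intro h
        obtain ⟨u, hcu, hu⟩ := Relation.TransGen.tail'_iff.1 h
        have hc : c ≠ D.root := fun h => hT.no_arc_to_root b (h ▸ hbc)
        have : u = b := (hT.existsUnique_father c hc).unique hu hbc
        subst this
        exact ih (Relation.TransGen.head' hbc hcu)
    exact fun v => key v (hT.reachable v)
  have wf : WellFounded (fun u v : V => Relation.TransGen T.Adj v u) :=
    haveI : IsTrans V (fun u v : V => Relation.TransGen T.Adj v u) := ⟨fun _ _ _ h1 h2 => h2.trans h1⟩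
    haveI : Std.Irrefl (fun u v : V => Relation.TransGen T.Adj v u) := ⟨hirr⟩
    Finite.wellFounded_of_trans_of_irrefl _
  induction v using wf.induction with
  | _ v ih =>
    by_cases hv : v ∈ leaves T
    · exact ⟨v, hv, .refl⟩
    · obtain ⟨w, hw⟩ : ∃ w, T.Adj v w := by
        by_contra! hc
        exact hv hc
      obtain ⟨l, hl, hwl⟩ := ih w (.single hw)
      exact ⟨l, hl, hwl.head hw⟩

/-- The number of leaves of an outbranching is at least the size of any antichain. -/
theorem IsOutbranching.ncard_le_of_antichain [Finite V] {T : Digraph V} (hT : D.IsOutbranching T)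
    (N : Set V) (hN : ∀ x ∈ N, ∀ y ∈ N, Relation.ReflTransGen T.Adj x y → x = y) :
    N.ncard ≤ (leaves T).ncard := by
  choose l hl hvl using hT.exists_leaf_descendant
  refine Set.ncard_le_ncard_of_injOn l (fun x _ => hl x) ?_ (Set.toFinite _)
  intro x hx y hy hxy
  -- Going backwards in `T` is deterministic, so two ancestors of the same leaf are comparable.
  have hu : Relator.RightUnique (Function.swap T.Adj) := by
    intro a b c hab hac
    have ha : a ≠ D.root := fun h => hT.no_arc_to_root b (h ▸ hab)
    exact (hT.existsUnique_father a ha).unique hab hac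
  have h1 : Relation.ReflTransGen (Function.swap T.Adj) (l x) x :=
    Relation.reflTransGen_swap.2 (hvl x)
  have h2 : Relation.ReflTransGen (Function.swap T.Adj) (l x) y :=
    Relation.reflTransGen_swap.2 (hxy ▸ hvl y)
  rcases Relation.ReflTransGen.total_of_right_unique hu h1 h2 with h | h
  · exact (hN y hy x hx (Relation.reflTransGen_swap.1 h)).symm
  · exact hN x hx y hy (Relation.reflTransGen_swap.1 h)

theorem IsReduced.reachable (hD : D.IsReduced) (v : V) :
    Relation.ReflTransGen D.Adj D.root v := by
  by_contra h
  exact hD.1 ⟨v, h⟩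

/-- If Rule (3) does not apply, some outbranching has at least as many leaves as a given vertex has
in-neighbours. -/
theorem IsReduced.exists_outbranching_inNbrs [Finite V] (hD : D.IsReduced) (s : V) :
    ∃ T, D.IsOutbranching T ∧ (D.inNbrs s).ncard ≤ (leaves T).ncard := by
  set N := D.inNbrs s with hN
  by_cases hr : D.root ∈ N
  · obtain ⟨T, hT, -⟩ := D.exists_outbranching_of_reachable D.Adj (fun _ _ h => h) hD.reachable
    refine ⟨T, hT, hT.ncard_le_of_antichain N ?_⟩
    intro x hx y hy _
    rw [D.eq_root_of_adj _ _ hr hx, D.eq_root_of_adj _ _ hr hy]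
  set R : Set V := {v | D.ReachableAvoiding N v} with hR
  have hRN : ∀ v ∈ R, v ∉ N := fun v hv => hv.2.1
  have hroot : D.root ∈ R := ⟨hr, hr, .refl⟩
  have hstep : ∀ u ∈ R, ∀ v, v ∉ N → D.Adj u v → v ∈ R := fun u hu v hv huv =>
    ⟨hr, hv, hu.2.2.tail ⟨huv, hu.2.1, hv⟩⟩
  -- Only arcs from `R` may enter `R ∪ N`. Every proper ancestor of a vertex of `N` then lies in
  -- `R`, which is disjoint from `N`, so `N` is an antichain.
  let E : V → V → Prop := fun u v => D.Adj u v ∧ (v ∈ R ∪ N → u ∈ R)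
  have hER : ∀ v, v ∈ R → Relation.ReflTransGen E D.root v := by
    rintro v ⟨-, -, hv⟩
    have : v ∈ R ∧ Relation.ReflTransGen E D.root v := by
      induction hv with
      | refl => exact ⟨hroot, .refl⟩
      | @tail b c _ hbc ih =>
        exact ⟨hstep b ih.1 c hbc.2.2 hbc.1, ih.2.tail ⟨hbc.1, fun _ => ih.1⟩⟩
    exact this.2
  have hEN : ∀ y ∈ N, Relation.ReflTransGen E D.root y := by
    intro y hy
    have hry : D.root ∉ N \ {y} := fun h => hr h.1
    have hreach : D.ReachableAvoiding (N \ {y}) y := by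
      by_contra hc
      exact hD.2.2.2 ⟨s, y, hy, hry, by simp, hc⟩
    -- A path to `y` avoiding the rest of `N` stays in `R` until it first reaches `y`.
    have key : ∀ v, Relation.ReflTransGen (fun u v => D.Adj u v ∧ u ∉ N \ {y} ∧ v ∉ N \ {y})
        D.root v → v ∈ R ∨ ∃ u ∈ R, D.Adj u y := by
      intro v hv
      induction hv with
      | refl => exact .inl hroot
      | @tail b c _ hbc ih =>
        rcases ih with hb | hb
        · by_cases hc : c ∈ N
          · have : c = y := by
              by_contra hne
              exact hbc.2.2 ⟨hc, hne⟩
            exact .inr ⟨b, hb, this ▸ hbc.1⟩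
          · exact .inl (hstep b hb c hc hbc.1)
        · exact .inr hb
    rcases key y hreach.2.2 with h | ⟨u, hu, huy⟩
    · exact absurd hy (hRN y h)
    · exact (hER u hu).tail ⟨huy, fun _ => hu⟩
  have hEall : ∀ v, Relation.ReflTransGen E D.root v := by
    intro v
    induction hD.reachable v with
    | refl => exact .refl
    | @tail b c _ hbc ih =>
      by_cases hc : c ∈ R ∪ N
      · exact hc.elim (hER c) (hEN c)
      · exact ih.tail ⟨hbc, fun h => absurd h hc⟩
  obtain ⟨T, hT, hTE⟩ := D.exists_outbranching_of_reachable E (fun _ _ h => h.1) hEall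
  refine ⟨T, hT, hT.ncard_le_of_antichain N ?_⟩
  intro x hx y hy hxy
  have key : x = y ∨ x ∈ R := by
    have : ∀ v, Relation.ReflTransGen T.Adj v y → v = y ∨ v ∈ R := by
      intro v hv
      induction hv using Relation.ReflTransGen.head_induction_on with
      | refl => exact .inl rfl
      | @head a c hac _ ih =>
        refine .inr ((hTE _ _ hac).2 ?_)
        rcases ih with rfl | h
        · exact .inr hy
        · exact .inl h
    exact this x hxy
  exact key.resolve_right fun h => hRN x h hx

end RootedDigraph

/-! ### Numberings from harmonic functions. -/

theorem exists_nat_rank {V α : Type*} [Finite V] [LinearOrder α] (κ : V → α) :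
    ∃ σ : V → ℕ, ∀ x y, σ x < σ y ↔ κ x < κ y := by
  classical
  have := Fintype.ofFinite V
  have key : ∀ x y, κ x < κ y → (Finset.univ.filter fun u => κ u < κ x).card <
      (Finset.univ.filter fun u => κ u < κ y).card := by
    intro x y hxy
    apply Finset.card_lt_card
    refine Finset.ssubset_iff_subset_ne.2 ⟨?_, fun h => ?_⟩
    · intro u hu
      simp only [Finset.mem_filter, Finset.mem_univ, true_and] at hu ⊢
      exact hu.trans hxy
    · have : x ∈ Finset.univ.filter fun u => κ u < κ x := by rw [h]; simpa using hxy
      simp at this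
  refine ⟨fun x => (Finset.univ.filter fun u => κ u < κ x).card, fun x y => ⟨fun h => ?_, key x y⟩⟩
  by_contra hc
  rcases (not_lt.1 hc).lt_or_eq with h' | h'
  · exact absurd (key y x h') (not_lt.2 h.le)
  · simp only [h'] at h
    exact lt_irrefl _ h

/-- The discrete Dirichlet problem: a function on `B` extends to a function which is harmonic with
respect to the in-neighbourhoods at the vertices of `C \ B`. -/
theorem exists_harmonic {V : Type*} [Fintype V] [DecidableEq V] (E : V → V → Prop)
    (C B : Finset V) (hB : ∀ U : Finset V, U ⊆ C \ B → U.Nonempty → ∃ u ∈ U, ∃ y ∈ C, y ∉ U ∧ E y u)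
    (b : V → ℝ) :
    ∃ g : V → ℝ, (∀ x ∈ B, g x = b x) ∧
      ∀ x ∈ C \ B, ∀ y ∈ C, E y x → g y ≠ g x →
        (∃ u ∈ C, E u x ∧ g u < g x) ∧ ∃ w ∈ C, E w x ∧ g x < g w := by
  classical
  let N : V → Finset V := fun x => C.filter fun y => E y x
  -- The in-neighbour Laplacian on `C \ B` and the identity elsewhere. Injectivity gives
  -- surjectivity in finite dimension, hence a solution.
  let M : (V → ℝ) →ₗ[ℝ] (V → ℝ) :=
    { toFun := fun g x => if x ∈ C \ B then ∑ y ∈ N x, (g x - g y) else g x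
      map_add' := by
        intro g h
        ext x
        by_cases hx : x ∈ C \ B
        · simp only [if_pos hx, Pi.add_apply, ← Finset.sum_add_distrib]
          exact Finset.sum_congr rfl fun _ _ => by ring
        · simp only [if_neg hx, Pi.add_apply]
      map_smul' := by
        intro c g
        ext x
        by_cases hx : x ∈ C \ B
        · simp only [if_pos hx, Pi.smul_apply, smul_eq_mul, RingHom.id_apply, Finset.mul_sum]
          exact Finset.sum_congr rfl fun _ _ => by ring
        · simp only [if_neg hx, Pi.smul_apply, RingHom.id_apply] }
  have hM : ∀ g x, M g x = if x ∈ C \ B then ∑ y ∈ N x, (g x - g y) else g x := fun _ _ => rfl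
  have hmax : ∀ g : V → ℝ, M g = 0 → ∀ x, g x ≤ 0 := by
    intro g hg
    by_contra! hc
    obtain ⟨x₀, hx₀⟩ := hc
    obtain ⟨m, -, hm⟩ := Finset.exists_max_image Finset.univ g ⟨x₀, Finset.mem_univ _⟩
    have hpos : 0 < g m := hx₀.trans_le (hm x₀ (Finset.mem_univ _))
    -- Maximum principle: the set where a positive maximum is attained lies in `C \ B`, and
    -- harmonicity forces the tail of any arc of `E` entering it from `C` to lie in it too.
    set U : Finset V := Finset.univ.filter fun x => g x = g m with hU
    have hUC : U ⊆ C \ B := by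
      intro x hx
      have hx' : g x = g m := by simpa [hU] using hx
      by_contra hxC
      have h := congrFun hg x
      rw [hM, if_neg hxC] at h
      rw [← hx', h] at hpos
      exact lt_irrefl _ hpos
    obtain ⟨u, hu, y, hyC, hyU, hyu⟩ := hB U hUC ⟨m, by simp [hU]⟩
    have hu' : g u = g m := by simpa [hU] using hu
    have h := congrFun hg u
    rw [hM, if_pos (hUC hu)] at h
    have h0 := (Finset.sum_eq_zero_iff_of_nonneg (fun z _ => by
      rw [hu']; exact sub_nonneg.2 (hm z (Finset.mem_univ _)))).1 h y
        (Finset.mem_filter.2 ⟨hyC, hyu⟩)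
    apply hyU
    simp only [hU, Finset.mem_filter, Finset.mem_univ, true_and]
    linarith
  have hinj : Function.Injective M := by
    rw [← LinearMap.ker_eq_bot, LinearMap.ker_eq_bot']
    intro g hg
    ext x
    refine le_antisymm (hmax g hg x) ?_
    have := hmax (-g) (by rw [map_neg, hg, neg_zero]) x
    simpa using this
  obtain ⟨g, hg⟩ := (LinearMap.injective_iff_surjective.1 hinj) (fun x => if x ∈ C \ B then 0 else b x)
  refine ⟨g, fun x hx => ?_, fun x hx y hy hyx hne => ?_⟩
  · have h := congrFun hg x
    have hx' : x ∉ C \ B := fun h => (Finset.mem_sdiff.1 h).2 hx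
    rwa [hM, if_neg hx', if_neg hx'] at h
  · have h := congrFun hg x
    rw [hM, if_pos hx, if_pos hx] at h
    have hyN : y ∈ N x := Finset.mem_filter.2 ⟨hy, hyx⟩
    constructor
    · by_contra! hc
      have h0 := (Finset.sum_eq_zero_iff_of_nonpos (fun z hz => by
        obtain ⟨hzC, hzx⟩ := Finset.mem_filter.1 hz
        exact sub_nonpos.2 (hc z hzC hzx))).1 h y hyN
      exact hne (by linarith)
    · by_contra! hc
      have h0 := (Finset.sum_eq_zero_iff_of_nonneg (fun z hz => by
        obtain ⟨hzC, hzx⟩ := Finset.mem_filter.1 hz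
        exact sub_nonneg.2 (hc z hzC hzx))).1 h y hyN
      exact hne (by linarith)

/-- If every nonempty subset of `C \ B` is entered from at least two vertices, there is an ordering
in which every vertex of `C \ B` lies between two of its in-neighbours. -/
theorem exists_numbering {V : Type*} [Fintype V] [DecidableEq V] (E : V → V → Prop) (C : Finset V) :
    ∀ B ⊆ C, (∀ U : Finset V, U ⊆ C \ B → U.Nonempty → ∃ y ∈ C, ∃ y' ∈ C, y ≠ y' ∧
        y ∉ U ∧ y' ∉ U ∧ (∃ u ∈ U, E y u) ∧ ∃ u ∈ U, E y' u) →
      ∃ σ : V → ℕ, Function.Injective σ ∧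
        ∀ x ∈ C \ B, ∃ u ∈ C, ∃ w ∈ C, E u x ∧ E w x ∧ σ u < σ x ∧ σ x < σ w := by
  classical
  induction C using Finset.strongInduction with
  | H C ih =>
    intro B hBC h
    by_cases hne : (C \ B).Nonempty
    swap
    · rw [Finset.not_nonempty_iff_eq_empty] at hne
      exact ⟨fun x => Fintype.equivFin V x, fun x y hxy => by simpa [Fin.val_inj] using hxy,
        by simp [hne]⟩
    obtain ⟨p, hp, q, hq, hpq, hp', hq', -⟩ := h _ subset_rfl hne
    have hpB : p ∈ B := by by_contra hc; exact hp' (Finset.mem_sdiff.2 ⟨hp, hc⟩)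
    have hqB : q ∈ B := by by_contra hc; exact hq' (Finset.mem_sdiff.2 ⟨hq, hc⟩)
    -- Boundary values 0 at `p` and 1 on the rest of `B`, in particular at `q`, make `g` nonconstant
    -- on `C`, so that its level sets are proper subsets.
    obtain ⟨g, hgB, hg⟩ := exists_harmonic E C B (fun U hU hU' => by
      obtain ⟨y, hy, -, -, -, hyU, -, ⟨u, hu, hyu⟩, -⟩ := h U hU hU'
      exact ⟨u, hu, y, hy, hyU, hyu⟩) (fun x => if x = p then 0 else 1)
    have hgp : g p = 0 := by simp [hgB p hpB]
    have hgq : g q = 1 := by simp [hgB q hqB, hpq.symm]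
    let L : ℝ → Finset V := fun c => C.filter fun x => g x = c
    have hLss : ∀ c, L c ⊂ C := fun c => by
      by_cases hc : c = 0
      · exact Finset.filter_ssubset.2 ⟨q, hq, by rw [hgq, hc]; norm_num⟩
      · exact Finset.filter_ssubset.2 ⟨p, hp, by rw [hgp]; exact Ne.symm hc⟩
    -- Vertices with an in-neighbour on another level already lie between two in-neighbours by
    -- harmonicity, so they join the boundary of their level. For the others all in-neighbours in
    -- `C` are on the same level, so the hypothesis passes to the level.
    let K : ℝ → Finset V := fun c =>
      (L c).filter fun x => x ∈ B ∨ ∃ y ∈ C, E y x ∧ g y ≠ g x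
    have hK : ∀ c, ∃ σ : V → ℕ, Function.Injective σ ∧ ∀ x ∈ L c \ K c,
        ∃ u ∈ L c, ∃ w ∈ L c, E u x ∧ E w x ∧ σ u < σ x ∧ σ x < σ w := by
      intro c
      refine ih (L c) (hLss c) (K c) (Finset.filter_subset _ _) fun U hU hUne => ?_
      have hmem : ∀ u ∈ U, (u ∈ C ∧ g u = c) ∧ u ∉ B ∧ ∀ y ∈ C, E y u → g y = g u := by
        intro u hu
        obtain ⟨h1, h2⟩ := Finset.mem_sdiff.1 (hU hu)
        have h3 : ¬ (u ∈ B ∨ ∃ y ∈ C, E y u ∧ g y ≠ g u) := fun h3 =>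
          h2 (Finset.mem_filter.2 ⟨h1, h3⟩)
        push Not at h3
        exact ⟨Finset.mem_filter.1 h1, h3⟩
      obtain ⟨y, hy, y', hy', hyy, hyU, hyU', ⟨u, hu, hyu⟩, u', hu', hyu'⟩ := h U
        (fun u hu => Finset.mem_sdiff.2 ⟨(hmem u hu).1.1, (hmem u hu).2.1⟩) hUne
      exact ⟨y, Finset.mem_filter.2 ⟨hy, ((hmem u hu).2.2 y hy hyu).trans (hmem u hu).1.2⟩,
        y', Finset.mem_filter.2 ⟨hy', ((hmem u' hu').2.2 y' hy' hyu').trans (hmem u' hu').1.2⟩,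
        hyy, hyU, hyU', ⟨u, hu, hyu⟩, u', hu', hyu'⟩
    choose τ hτ hτ' using hK
    obtain ⟨σ, hσ⟩ := exists_nat_rank fun x => toLex (g x, τ (g x) x)
    have hσ' : ∀ x y, σ x < σ y ↔ g x < g y ∨ g x = g y ∧ τ (g x) x < τ (g y) y := fun x y => by
      rw [hσ, Prod.Lex.toLex_lt_toLex]
    refine ⟨σ, ?_, ?_⟩
    · intro x y hxy
      have h1 := mt (hσ' x y).2 (by omega)
      have h2 := mt (hσ' y x).2 (by omega)
      push Not at h1 h2
      have hgxy : g x = g y := le_antisymm h2.1 h1.1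
      refine hτ (g x) (le_antisymm ?_ ?_)
      · simpa [hgxy] using h2.2 hgxy.symm
      · simpa [hgxy] using h1.2 hgxy
    · intro x hx
      obtain ⟨hxC, hxB⟩ := Finset.mem_sdiff.1 hx
      by_cases hxK : ∃ y ∈ C, E y x ∧ g y ≠ g x
      · obtain ⟨y, hy, hyx, hne⟩ := hxK
        obtain ⟨⟨u, hu, hux, hlt⟩, w, hw, hwx, hlt'⟩ := hg x hx y hy hyx hne
        exact ⟨u, hu, w, hw, hux, hwx, (hσ' _ _).2 (.inl hlt), (hσ' _ _).2 (.inl hlt')⟩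
      · have hxL : x ∈ L (g x) := Finset.mem_filter.2 ⟨hxC, rfl⟩
        have hxK' : x ∉ K (g x) := fun hx' => (Finset.mem_filter.1 hx').2.elim hxB hxK
        obtain ⟨u, hu, w, hw, hux, hwx, hlt, hlt'⟩ :=
          hτ' (g x) x (Finset.mem_sdiff.2 ⟨hxL, hxK'⟩)
        obtain ⟨huC, hgu⟩ := Finset.mem_filter.1 hu
        obtain ⟨hwC, hgw⟩ := Finset.mem_filter.1 hw
        exact ⟨u, huC, w, hwC, hux, hwx, (hσ' _ _).2 (.inr ⟨hgu, by rwa [hgu]⟩),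
          (hσ' _ _).2 (.inr ⟨hgw.symm, by rwa [hgw]⟩)⟩

/-! ### Tree paths and the two preorders of a tree. -/

theorem List.lt_append_singleton {α : Type*} [LinearOrder α] (l : List α) (a : α) :
    l < l ++ [a] := by
  induction l with
  | nil => exact List.nil_lt_cons a []
  | cons b l ih => exact List.cons_lt_cons_iff.2 (.inr ⟨rfl, ih⟩)

/-- Lists which are not comparable as prefixes are ordered differently by the lexicographic orders
for an order of the letters and for its dual. -/
theorem List.lt_or_map_toDual_lt {α : Type*} [LinearOrder α] (l : List α) :
    ∀ l' : List α, ¬ l' <+: l → l < l' ∨ l.map OrderDual.toDual < l'.map OrderDual.toDual := by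
  induction l with
  | nil =>
    rintro (_ | ⟨b, l'⟩) h
    · exact absurd List.nil_prefix h
    · exact .inl (List.nil_lt_cons _ _)
  | cons a l ih =>
    rintro (_ | ⟨b, l'⟩) h
    · exact absurd List.nil_prefix h
    · simp only [List.map_cons, List.cons_lt_cons_iff]
      rcases lt_trichotomy a b with hab | rfl | hab
      · exact .inl (.inl hab)
      · rcases ih l' (fun h' => h (List.cons_prefix_cons.2 ⟨rfl, h'⟩)) with h' | h'
        · exact .inl (.inr ⟨rfl, h'⟩)
        · exact .inr (.inr ⟨rfl, h'⟩)
      · exact .inr (.inl (OrderDual.toDual_lt_toDual.2 hab))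

/-- `path v` lists the vertices other than `r` on the path from `r` to `v` in the tree with father
function `f`. -/
structure IsTreePath {V : Type*} (f : V → V) (r : V) (path : V → List V) : Prop where
  root : path r = []
  father : ∀ v, v ≠ r → path v = path (f v) ++ [v]

section TreePath

variable {V : Type*} {f : V → V} {r : V} {α : Type*} [Preorder α] {ρ : V → α}

theorem wellFounded_rank [Finite V] (ρ : V → α) : WellFounded fun u v : V => ρ u < ρ v :=
  have : IsTrans V (fun u v : V => ρ u < ρ v) := ⟨fun _ _ _ => lt_trans⟩
  have : Std.Irrefl (fun u v : V => ρ u < ρ v) := ⟨fun _ => lt_irrefl _⟩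
  Finite.wellFounded_of_trans_of_irrefl _

theorem exists_isTreePath [Finite V] (hρ : ∀ v, v ≠ r → ρ (f v) < ρ v) :
    ∃ path, IsTreePath f r path := by
  classical
  let F : (v : V) → ((u : V) → ρ u < ρ v → List V) → List V := fun v p =>
    if h : v = r then [] else p (f v) (hρ v h) ++ [v]
  have hF : ∀ v, (wellFounded_rank ρ).fix F v = F v fun u _ => (wellFounded_rank ρ).fix F u :=
    (wellFounded_rank ρ).fix_eq F
  refine ⟨(wellFounded_rank ρ).fix F, ?_, fun v hv => ?_⟩
  · rw [hF]
    simp [F]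
  · rw [hF]
    simp [F, hv]

variable {path : V → List V}

theorem IsTreePath.mem_self (hp : IsTreePath f r path) {v : V} (hv : v ≠ r) : v ∈ path v := by
  rw [hp.father v hv]
  simp

theorem IsTreePath.rank_le [Finite V] (hp : IsTreePath f r path)
    (hρ : ∀ v, v ≠ r → ρ (f v) < ρ v) {u w : V} (hw : w ∈ path u) : w ≠ r ∧ ρ w ≤ ρ u := by
  induction u using (wellFounded_rank ρ).induction with
  | _ u ih =>
    by_cases hu : u = r
    · rw [hu, hp.root] at hw
      simp at hw
    · rw [hp.father u hu, List.mem_append, List.mem_singleton] at hw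
      rcases hw with hw | rfl
      · have := ih _ (hρ u hu) hw
        exact ⟨this.1, this.2.trans (hρ u hu).le⟩
      · exact ⟨hu, le_rfl⟩

theorem IsTreePath.exists_child [Finite V] (hp : IsTreePath f r path)
    (hρ : ∀ v, v ≠ r → ρ (f v) < ρ v) {u v : V} (hv : v ∈ path u) (hne : v ≠ u) :
    ∃ w ∈ path u, w ≠ r ∧ f w = v := by
  induction u using (wellFounded_rank ρ).induction with
  | _ u ih =>
    by_cases hu : u = r
    · rw [hu, hp.root] at hv
      simp at hv
    · by_cases hfu : f u = v
      · exact ⟨u, hp.mem_self hu, hu, hfu⟩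
      · have hv' : v ∈ path (f u) := by
          rw [hp.father u hu, List.mem_append, List.mem_singleton] at hv
          exact hv.resolve_right hne
        obtain ⟨w, hw, h⟩ := ih _ (hρ u hu) hv' (Ne.symm hfu)
        refine ⟨w, ?_, h⟩
        rw [hp.father u hu]
        exact List.mem_append_left _ hw

/-- The left-to-right and right-to-left preorders of a tree. -/
theorem IsTreePath.exists_preorders [Fintype V] (hp : IsTreePath f r path) :
    ∃ κ κ' : V → ℕ, (∀ v, v ≠ r → κ (f v) < κ v ∧ κ' (f v) < κ' v) ∧
      ∀ u v, v ≠ r → v ∉ path u → κ u < κ v ∨ κ' u < κ' v := by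
  classical
  let _ : LinearOrder V := LinearOrder.lift' (Fintype.equivFin V) (Fintype.equivFin V).injective
  -- Comparing root paths lexicographically gives a preorder; dualising the order of the letters
  -- reverses siblings but keeps ancestors first.
  obtain ⟨κ, hκ⟩ := exists_nat_rank path
  obtain ⟨κ', hκ'⟩ := exists_nat_rank fun v => (path v).map OrderDual.toDual
  refine ⟨κ, κ', fun v hv => ?_, fun u v hv hvu => ?_⟩
  · rw [hκ, hκ', hp.father v hv, List.map_append]
    exact ⟨List.lt_append_singleton _ _, List.lt_append_singleton _ _⟩
  · rw [hκ, hκ']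
    exact List.lt_or_map_toDual_lt _ _ fun h => hvu (h.subset (hp.mem_self hv))

end TreePath

/-! ### Arcs transverse to an outbranching. -/

namespace RootedDigraph

variable {V : Type*} {D : RootedDigraph V}

/-- Few arcs can be transverse to an outbranching if no outbranching has many leaves. -/
theorem card_transverse_le [Fintype V] [DecidableEq V] {b f : V → V} {path : V → List V}
    (hp : IsTreePath b D.root path) (hb : ∀ v, v ≠ D.root → D.Adj (b v) v) {O H : Finset V}
    (hO : ∀ v ∈ O, D.Adj D.root v)
    (hH : ∀ v ∈ H, v ≠ D.root ∧ D.Adj (f v) v ∧ f v ≠ b v ∧ v ∉ path (f v)) {m : ℕ}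
    (hm : ∀ T, D.IsOutbranching T → 3 * (leaves T).ncard ≤ m) :
    H.card + 4 * O.card ≤ 2 * m := by
  classical
  obtain ⟨κ, κ', hκ, hκH⟩ := hp.exists_preorders
  -- The tree plus the arcs of `H` forward for `π` is acyclic, and the heads of these arcs have two
  -- in-neighbours.
  have key : ∀ π : V → ℕ, (∀ v, v ≠ D.root → π (b v) < π v) →
      (H.filter fun v => π (f v) < π v).card + 2 * O.card ≤ m := by
    intro π hπ
    obtain ⟨T, hT, hcard⟩ := D.exists_outbranching_of_acyclic π
      (fun u v => v ≠ D.root ∧ (u = b v ∨ v ∈ H ∧ u = f v ∧ π u < π v)) (by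
        rintro u v ⟨hv, rfl | ⟨hvH, rfl, -⟩⟩
        · exact hb v hv
        · exact (hH v hvH).2.1) (by
        rintro u v ⟨hv, rfl | ⟨-, rfl, h⟩⟩
        · exact hπ v hv
        · exact h) (fun v hv => ⟨b v, hv, .inl rfl⟩)
      (H.filter fun v => π (f v) < π v) O (by
        intro v hv
        obtain ⟨hvH, hlt⟩ := Finset.mem_filter.1 hv
        obtain ⟨hv1, -, hne, -⟩ := hH v hvH
        exact ⟨f v, b v, hne, ⟨hv1, .inr ⟨hvH, rfl, hlt⟩⟩, hv1, .inl rfl⟩) hO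
    exact hcard.trans (hm T hT)
  have h1 := key κ fun v hv => (hκ v hv).1
  have h2 := key κ' fun v hv => (hκ v hv).2
  have h3 : H ⊆ (H.filter fun v => κ (f v) < κ v) ∪ H.filter fun v => κ' (f v) < κ' v := by
    intro v hv
    obtain ⟨hv1, -, -, hvp⟩ := hH v hv
    rw [← Finset.filter_or]
    exact Finset.mem_filter.2 ⟨hv, hκH _ _ hv1 hvp⟩
  have h4 := (Finset.card_le_card h3).trans (Finset.card_union_le _ _)
  omega

variable (D) in
/-- `f` is the father function of an outbranching of `D` whose arcs not leaving the root increase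
`σ`. -/
structure IsFather {α : Type*} [LinearOrder α] (σ : V → α) (f : V → V) : Prop where
  adj : ∀ v, v ≠ D.root → D.Adj (f v) v
  lt : ∀ v, v ≠ D.root → f v = D.root ∨ σ (f v) < σ v

variable (D) in
open Classical in
/-- The rank `σ`, modified so that the root has the lowest rank. -/
noncomputable def rootRank {α : Type*} (σ : V → α) (v : V) : WithBot α :=
  if v = D.root then ⊥ else (σ v : WithBot α)

theorem rootRank_lt {α : Type*} [LinearOrder α] {σ : V → α} {u v : V} (hv : v ≠ D.root)
    (h : u = D.root ∨ σ u < σ v) : D.rootRank σ u < D.rootRank σ v := by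
  rw [rootRank, rootRank, if_neg hv]
  split_ifs with hu
  · exact WithBot.bot_lt_coe _
  · exact WithBot.coe_lt_coe.2 (h.resolve_left hu)

theorem IsFather.rootRank_lt {α : Type*} [LinearOrder α] {σ : V → α} {f : V → V}
    (hf : D.IsFather σ f) (v : V) (hv : v ≠ D.root) : D.rootRank σ (f v) < D.rootRank σ v :=
  RootedDigraph.rootRank_lt hv (hf.lt v hv)

theorem IsFather.le_of_mem_path [Finite V] {α : Type*} [LinearOrder α] {σ : V → α} {f : V → V}
    (hf : D.IsFather σ f) {path : V → List V} (hp : IsTreePath f D.root path) {u w : V}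
    (hw : w ∈ path u) : w ≠ D.root ∧ σ w ≤ σ u := by
  obtain ⟨h1, h2⟩ := hp.rank_le hf.rootRank_lt hw
  have hu : u ≠ D.root := by
    rintro rfl
    rw [hp.root] at hw
    simp at hw
  rw [rootRank, rootRank, if_neg h1, if_neg hu, WithBot.coe_le_coe] at h2
  exact ⟨h1, h2⟩

/-- If an increasing arc `(f v, v)` which is not in a 2-cycle is not transverse to the decreasing
tree, then some arc leaving `v` in the decreasing tree is transverse to the increasing tree. -/
theorem exists_transverse [Finite V] {α β : Type*} [LinearOrder α] [LinearOrder β] {σ : V → α}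
    {τ : V → β} (hσ : Function.Injective σ) (hτ : ∀ u v, τ u < τ v ↔ σ v < σ u) {f b : V → V}
    {pf pb : V → List V} (hf : D.IsFather σ f) (hb : D.IsFather τ b)
    (hpf : IsTreePath f D.root pf) (hpb : IsTreePath b D.root pb) {v : V} (hv : v ≠ D.root)
    (hfv : f v ≠ D.root) (hnice : ¬ D.Adj v (f v)) (hmem : v ∈ pb (f v)) :
    ∃ w, w ≠ D.root ∧ b w = v ∧ w ∉ pf (b w) := by
  have hlt : σ (f v) < σ v := (hf.lt v hv).resolve_left hfv
  have hne : v ≠ f v := fun h => hlt.ne (congrArg σ h.symm)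
  -- The child `w` of `v` on the decreasing path to `f v` satisfies `σ (f v) < σ w`, since `w = f v`
  -- would create a 2-cycle. The ancestors of `v` in the increasing tree, apart from `v`, have rank
  -- at most `σ (f v)`, so `w` is not among them.
  obtain ⟨w, hw, hwr, hwv⟩ := hpb.exists_child hb.rootRank_lt hmem hne
  refine ⟨w, hwr, hwv, fun hc => ?_⟩
  have hwf : w ≠ f v := by
    intro h
    have hadj := hb.adj w hwr
    rw [hwv, h] at hadj
    exact hnice hadj
  have h1 : σ (f v) < σ w := by
    have h := (hb.le_of_mem_path hpb hw).2
    rw [← not_lt, hτ, not_lt] at h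
    exact lt_of_le_of_ne h fun h => hwf (hσ h.symm)
  have h2 : w ≠ v := by
    intro h
    have hlt' := hb.lt w hwr
    rw [hwv, h] at hlt'
    exact hlt'.elim hv (lt_irrefl _)
  rw [hwv, hpf.father v hv, List.mem_append, List.mem_singleton] at hc
  exact not_lt.2 (hf.le_of_mem_path hpf (hc.resolve_right h2)).2 h1

/-- Each `v` in `S` is charged to its own arc `(f v, v)` if that is transverse to the decreasing
tree, and otherwise to the transverse arc leaving `v` from `exists_transverse`. -/
theorem card_simple_le [Fintype V] [DecidableEq V] {α β : Type*} [LinearOrder α] [LinearOrder β]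
    {σ : V → α} {τ : V → β} (hσ : Function.Injective σ) (hτ : ∀ u v, τ u < τ v ↔ σ v < σ u)
    {f b : V → V} {pf pb : V → List V} (hf : D.IsFather σ f) (hb : D.IsFather τ b)
    (hpf : IsTreePath f D.root pf) (hpb : IsTreePath b D.root pb) {S Hf Hb : Finset V}
    (hS : ∀ v ∈ S, v ≠ D.root ∧ ¬ D.Adj D.root v ∧ ¬ D.Adj v (f v))
    (hHb : ∀ v, v ≠ D.root → ¬ D.Adj D.root v → v ∉ pb (f v) → v ∈ Hb)
    (hHf : ∀ v, v ≠ D.root → ¬ D.Adj D.root v → v ∉ pf (b v) → v ∈ Hf) :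
    S.card ≤ Hb.card + Hf.card := by
  have hsub : S ⊆ Hb ∪ Hf.image b := by
    intro v hv
    obtain ⟨hvr, hvO, hnice⟩ := hS v hv
    by_cases hmem : v ∈ pb (f v)
    · have hfv : f v ≠ D.root := fun h => hvO (h ▸ hf.adj v hvr)
      obtain ⟨w, hwr, rfl, hw⟩ := exists_transverse hσ hτ hf hb hpf hpb hvr hfv hnice hmem
      refine Finset.mem_union_right _ (Finset.mem_image_of_mem b (hHf w hwr (fun h => ?_) hw))
      exact hvr (D.eq_root_of_adj _ _ h (hb.adj w hwr))
    · exact Finset.mem_union_left _ (hHb v hvr hvO hmem)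
  exact (Finset.card_le_card hsub).trans ((Finset.card_union_le _ _).trans
    (Nat.add_le_add_left Finset.card_image_le _))

end RootedDigraph

/-! ### Numbering a reduced digraph and counting its special vertices. -/

namespace RootedDigraph

variable {V : Type*} {D : RootedDigraph V}

/-- A path from the root enters `U` from some `y`, which is not the root. As `y` is no cutvertex, a
second path avoids it and enters `U` from elsewhere. -/
theorem IsReduced.exists_two_entries (hD : D.IsReduced) {U : Finset V} (hU : U.Nonempty)
    (hUr : ∀ u ∈ U, u ≠ D.root ∧ ¬ D.Adj D.root u) :
    ∃ y y', y ≠ y' ∧ y ∉ U ∧ y' ∉ U ∧ (∃ u ∈ U, D.Adj y u) ∧ ∃ u ∈ U, D.Adj y' u := by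
  obtain ⟨z, hz⟩ := hU
  have entry : ∀ R : V → V → Prop, Relation.ReflTransGen R D.root z →
      ∃ y, y ∉ U ∧ ∃ u ∈ U, R y u := by
    intro R hR
    have key : ∀ v, Relation.ReflTransGen R D.root v → v ∉ U ∨ ∃ y, y ∉ U ∧ ∃ u ∈ U, R y u := by
      intro v hv
      induction hv with
      | refl => exact .inl fun h => (hUr _ h).1 rfl
      | @tail b c _ hbc ih =>
        rcases ih with hb | h
        · by_cases hc : c ∈ U
          · exact .inr ⟨b, hb, c, hc, hbc⟩
          · exact .inl hc
        · exact .inr h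
    exact (key z hR).resolve_left fun h => h hz
  obtain ⟨y, hy, u, hu, hyu⟩ := entry _ (hD.reachable z)
  have hreach : D.ReachableAvoiding {y} z := by
    by_contra hc
    refine hD.2.1 ⟨y, z, ?_, ?_, hc⟩
    · rintro (h : D.root = y)
      exact (hUr u hu).2 (h ▸ hyu)
    · rintro (h : z = y)
      exact hy (h ▸ hz)
  obtain ⟨y', hy', u', hu', hyu'⟩ := entry _ hreach.2.2
  exact ⟨y, y', fun h => hyu'.2.1 h.symm, hy, hy', ⟨u, hu, hyu⟩, u', hu', hyu'.1⟩

theorem IsReduced.exists_numbering [Fintype V] (hD : D.IsReduced) :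
    ∃ σ : V → ℕ, Function.Injective σ ∧ ∀ x, x ≠ D.root → ¬ D.Adj D.root x →
      (∃ u, D.Adj u x ∧ σ u < σ x) ∧ ∃ w, D.Adj w x ∧ σ x < σ w := by
  classical
  have hmem : ∀ x, x ∈ Finset.univ.erase D.root \ Finset.univ.filter (D.Adj D.root) ↔
      x ≠ D.root ∧ ¬ D.Adj D.root x := by simp
  obtain ⟨σ, hσ, h⟩ := _root_.exists_numbering D.Adj (Finset.univ.erase D.root)
    (Finset.univ.filter (D.Adj D.root)) (by
      intro v hv
      rw [Finset.mem_filter] at hv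
      exact Finset.mem_erase.2 ⟨fun h => D.no_arc_to_root _ (h ▸ hv.2), Finset.mem_univ _⟩) (by
      intro U hU hUne
      have hUr : ∀ u ∈ U, u ≠ D.root ∧ ¬ D.Adj D.root u := fun u hu => (hmem u).1 (hU hu)
      obtain ⟨y, y', hne, hy, hy', ⟨u, hu, hyu⟩, u', hu', hyu'⟩ := hD.exists_two_entries hUne hUr
      exact ⟨y, by simpa using fun h : y = D.root => (hUr u hu).2 (h ▸ hyu), y',
        by simpa using fun h : y' = D.root => (hUr u' hu').2 (h ▸ hyu'), hne, hy, hy', ⟨u, hu, hyu⟩,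
        u', hu', hyu'⟩)
  refine ⟨σ, hσ, fun x hx hrx => ?_⟩
  obtain ⟨u, -, w, -, hux, hwx, h1, h2⟩ := h x ((hmem x).2 ⟨hx, hrx⟩)
  exact ⟨⟨u, hux, h1⟩, w, hwx, h2⟩

/-- Fathers are chosen along arcs outside 2-cycles whenever possible, so that an arc of this kind
can be assumed to be a tree arc. -/
theorem exists_isFather {α : Type*} [LinearOrder α] (τ : V → α)
    (h : ∀ v, v ≠ D.root → ¬ D.Adj D.root v → ∃ u, D.Adj u v ∧ τ u < τ v) :
    ∃ f, D.IsFather τ f ∧ ∀ v, v ≠ D.root → ¬ D.Adj D.root v →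
      (∃ u, D.Adj u v ∧ τ u < τ v ∧ ¬ D.Adj v u) → ¬ D.Adj v (f v) := by
  have key : ∀ v, v ≠ D.root → ∃ u, D.Adj u v ∧ (u = D.root ∨ τ u < τ v) ∧
      (¬ D.Adj D.root v → (∃ u, D.Adj u v ∧ τ u < τ v ∧ ¬ D.Adj v u) → ¬ D.Adj v u) := by
    intro v hv
    by_cases hr : D.Adj D.root v
    · exact ⟨D.root, hr, .inl rfl, fun h => absurd hr h⟩
    · by_cases hs : ∃ u, D.Adj u v ∧ τ u < τ v ∧ ¬ D.Adj v u
      · obtain ⟨u, h1, h2, h3⟩ := hs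
        exact ⟨u, h1, .inr h2, fun _ _ => h3⟩
      · obtain ⟨u, h1, h2⟩ := h v hv hr
        exact ⟨u, h1, .inr h2, fun _ h => absurd h hs⟩
  choose! f h1 h2 h3 using key
  exact ⟨f, ⟨h1, h2⟩, h3⟩

/-- Few vertices have an in-arc which is not in a 2-cycle if no outbranching has many leaves. -/
theorem IsReduced.card_nice_le [Fintype V] [DecidableEq V] (hD : D.IsReduced) {O S : Finset V}
    (hO : ∀ v ∈ O, D.Adj D.root v)
    (hS : ∀ v ∈ S, v ≠ D.root ∧ ¬ D.Adj D.root v ∧ ∃ u, D.Adj u v ∧ ¬ D.Adj v u) {m : ℕ}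
    (hm : ∀ T, D.IsOutbranching T → 3 * (leaves T).ncard ≤ m) :
    S.card + 16 * O.card ≤ 8 * m := by
  classical
  obtain ⟨σ, hσ, hnum⟩ := hD.exists_numbering
  let τ : V → ℕᵒᵈ := fun v => OrderDual.toDual (σ v)
  have hτ : Function.Injective τ := fun u v h => hσ (OrderDual.toDual.injective h)
  have hτσ : ∀ u v, τ u < τ v ↔ σ v < σ u := fun u v => OrderDual.toDual_lt_toDual
  obtain ⟨f, hf, hfs⟩ := exists_isFather σ fun v hv hr => (hnum v hv hr).1
  obtain ⟨b, hb, hbs⟩ := exists_isFather τ fun v hv hr => (hnum v hv hr).2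
  obtain ⟨pf, hpf⟩ := exists_isTreePath hf.rootRank_lt
  obtain ⟨pb, hpb⟩ := exists_isTreePath hb.rootRank_lt
  have hfb : ∀ v, v ≠ D.root → ¬ D.Adj D.root v → f v ≠ b v := by
    intro v hv hr h
    have h1 := (hf.lt v hv).resolve_left fun h => hr (h ▸ hf.adj v hv)
    have h2 := (hb.lt v hv).resolve_left fun h => hr (h ▸ hb.adj v hv)
    rw [hτσ, ← h] at h2
    exact lt_asymm h1 h2
  let Hf := Finset.univ.filter fun v => v ≠ D.root ∧ ¬ D.Adj D.root v ∧ v ∉ pf (b v)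
  let Hb := Finset.univ.filter fun v => v ≠ D.root ∧ ¬ D.Adj D.root v ∧ v ∉ pb (f v)
  have hHf : Hf.card + 4 * O.card ≤ 2 * m := card_transverse_le (f := b) hpf hf.adj hO (by
    intro v hv
    obtain ⟨-, h1, h2, h3⟩ := Finset.mem_filter.1 hv
    exact ⟨h1, hb.adj v h1, (hfb v h1 h2).symm, h3⟩) hm
  have hHb : Hb.card + 4 * O.card ≤ 2 * m := card_transverse_le (f := f) hpb hb.adj hO (by
    intro v hv
    obtain ⟨-, h1, h2, h3⟩ := Finset.mem_filter.1 hv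
    exact ⟨h1, hf.adj v h1, hfb v h1 h2, h3⟩) hm
  have hSf : (S.filter fun v => ¬ D.Adj v (f v)).card ≤ Hb.card + Hf.card :=
    card_simple_le hσ hτσ hf hb hpf hpb (fun v hv => by
      obtain ⟨h1, h2⟩ := Finset.mem_filter.1 hv
      exact ⟨(hS v h1).1, (hS v h1).2.1, h2⟩)
      (fun v h1 h2 h3 => Finset.mem_filter.2 ⟨Finset.mem_univ _, h1, h2, h3⟩)
      (fun v h1 h2 h3 => Finset.mem_filter.2 ⟨Finset.mem_univ _, h1, h2, h3⟩)
  have hSb : (S.filter fun v => ¬ D.Adj v (b v)).card ≤ Hf.card + Hb.card :=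
    card_simple_le hτ (fun u v => (hτσ v u).symm) hb hf hpb hpf (fun v hv => by
      obtain ⟨h1, h2⟩ := Finset.mem_filter.1 hv
      exact ⟨(hS v h1).1, (hS v h1).2.1, h2⟩)
      (fun v h1 h2 h3 => Finset.mem_filter.2 ⟨Finset.mem_univ _, h1, h2, h3⟩)
      (fun v h1 h2 h3 => Finset.mem_filter.2 ⟨Finset.mem_univ _, h1, h2, h3⟩)
  -- An in-arc of `v` outside 2-cycles is increasing or decreasing, so the father of `v` in the
  -- corresponding tree is joined to it by such an arc.
  have hsub : S ⊆ (S.filter fun v => ¬ D.Adj v (f v)) ∪ S.filter fun v => ¬ D.Adj v (b v) := by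
    intro v hv
    obtain ⟨hvr, hr, u, huv, hvu⟩ := hS v hv
    rw [← Finset.filter_or]
    refine Finset.mem_filter.2 ⟨hv, ?_⟩
    rcases lt_trichotomy (σ u) (σ v) with h | h | h
    · exact .inl (hfs v hvr hr ⟨u, huv, h, hvu⟩)
    · exact absurd (hσ h ▸ huv) (D.loopless v)
    · exact .inr (hbs v hvr hr ⟨u, huv, (hτσ u v).2 h, hvu⟩)
  have := (Finset.card_le_card hsub).trans (Finset.card_union_le _ _)
  omega

/-- Few vertices have indegree at least three if no outbranching has many leaves. -/
theorem IsReduced.card_three_le [Fintype V] [DecidableEq V] (hD : D.IsReduced) {O S : Finset V}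
    (hO : ∀ v ∈ O, D.Adj D.root v)
    (hS : ∀ v ∈ S, ∃ x y z, D.Adj x v ∧ D.Adj y v ∧ D.Adj z v ∧ x ≠ y ∧ x ≠ z ∧ y ≠ z) {m : ℕ}
    (hm : ∀ T, D.IsOutbranching T → 3 * (leaves T).ncard ≤ m) :
    S.card + 4 * O.card ≤ 2 * m := by
  classical
  obtain ⟨σ, hσ, hnum⟩ := hD.exists_numbering
  let τ : V → ℕᵒᵈ := fun v => OrderDual.toDual (σ v)
  have key : ∀ {α : Type} [LinearOrder α] (π : V → α),
      (∀ v, v ≠ D.root → ¬ D.Adj D.root v → ∃ u, D.Adj u v ∧ π u < π v) →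
      (S.filter fun v => ∃ u u', u ≠ u' ∧ (D.Adj u v ∧ π u < π v) ∧
        D.Adj u' v ∧ π u' < π v).card + 2 * O.card ≤ m := by
    intro α _ π hπ
    obtain ⟨T, hT, hcard⟩ := D.exists_outbranching_of_acyclic (D.rootRank π)
      (fun u v => D.Adj u v ∧ (u = D.root ∨ π u < π v)) (fun _ _ h => h.1)
      (fun u v h => rootRank_lt (fun hv => D.no_arc_to_root u (hv ▸ h.1)) h.2) (by
        intro v hv
        by_cases hr : D.Adj D.root v
        · exact ⟨_, hr, .inl rfl⟩
        · obtain ⟨u, h1, h2⟩ := hπ v hv hr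
          exact ⟨u, h1, .inr h2⟩)
      (S.filter fun v => ∃ u u', u ≠ u' ∧ (D.Adj u v ∧ π u < π v) ∧ D.Adj u' v ∧ π u' < π v) O (by
        intro v hv
        obtain ⟨-, u, u', hne, h1, h2⟩ := Finset.mem_filter.1 hv
        exact ⟨u, u', hne, ⟨h1.1, .inr h1.2⟩, h2.1, .inr h2.2⟩) hO
    exact hcard.trans (hm T hT)
  have h1 := key σ fun v hv hr => (hnum v hv hr).1
  have h2 := key τ fun v hv hr => (hnum v hv hr).2
  have hsub : S ⊆ (S.filter fun v => ∃ u u', u ≠ u' ∧ (D.Adj u v ∧ σ u < σ v) ∧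
        D.Adj u' v ∧ σ u' < σ v) ∪
      S.filter fun v => ∃ u u', u ≠ u' ∧ (D.Adj u v ∧ τ u < τ v) ∧ D.Adj u' v ∧ τ u' < τ v := by
    intro v hv
    rw [← Finset.filter_or]
    refine Finset.mem_filter.2 ⟨hv, ?_⟩
    obtain ⟨x, y, z, hx, hy, hz, hxy, hxz, hyz⟩ := hS v hv
    have hcmp : ∀ u, D.Adj u v → σ u < σ v ∨ τ u < τ v := by
      intro u hu
      rcases lt_trichotomy (σ u) (σ v) with h | h | h
      · exact .inl h
      · exact absurd (hσ h ▸ hu) (D.loopless v)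
      · exact .inr (OrderDual.toDual_lt_toDual.2 h)
    rcases hcmp x hx with h | h <;> rcases hcmp y hy with h' | h' <;>
      rcases hcmp z hz with h'' | h''
    · exact .inl ⟨x, y, hxy, ⟨hx, h⟩, hy, h'⟩
    · exact .inl ⟨x, y, hxy, ⟨hx, h⟩, hy, h'⟩
    · exact .inl ⟨x, z, hxz, ⟨hx, h⟩, hz, h''⟩
    · exact .inr ⟨y, z, hyz, ⟨hy, h'⟩, hz, h''⟩
    · exact .inl ⟨y, z, hyz, ⟨hy, h'⟩, hz, h''⟩
    · exact .inr ⟨x, z, hxz, ⟨hx, h⟩, hz, h''⟩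
    · exact .inr ⟨x, y, hxy, ⟨hx, h⟩, hy, h'⟩
    · exact .inr ⟨x, y, hxy, ⟨hx, h⟩, hy, h'⟩
  have := (Finset.card_le_card hsub).trans (Finset.card_union_le _ _)
  omega

/-! ### Bipaths and the final count. -/

/-- A path whose internal vertices `x₁, x₂, x₃` have no neighbours off the path is a bipath. -/
theorem isBipath_four {x₀ x₁ x₂ x₃ x₄ : V} (hnd : [x₀, x₁, x₂, x₃, x₄].Nodup)
    (hin₁ : ∀ u, D.Adj u x₁ ↔ u = x₀ ∨ u = x₂) (hout₁ : ∀ u, D.Adj x₁ u ↔ u = x₀ ∨ u = x₂)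
    (hin₂ : ∀ u, D.Adj u x₂ ↔ u = x₁ ∨ u = x₃) (hout₂ : ∀ u, D.Adj x₂ u ↔ u = x₁ ∨ u = x₃)
    (hin₃ : ∀ u, D.Adj u x₃ ↔ u = x₂ ∨ u = x₄) (hout₃ : ∀ u, D.Adj x₃ u ↔ u = x₂ ∨ u = x₄) :
    D.IsBipath (l := 4) ![x₀, x₁, x₂, x₃, x₄] := by
  refine ⟨by norm_num, ?_, fun u v => ⟨?_, ?_⟩⟩
  · have : (List.ofFn ![x₀, x₁, x₂, x₃, x₄]).Nodup := by simpa [List.ofFn_succ] using hnd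
    exact List.nodup_ofFn.1 this
  · rintro ⟨huv, i, h0, h4, h⟩
    have hex : (u = x₀ ∧ v = x₁ ∨ u = x₁ ∧ v = x₀) ∨ (u = x₁ ∧ v = x₂ ∨ u = x₂ ∧ v = x₁) ∨
        (u = x₂ ∧ v = x₃ ∨ u = x₃ ∧ v = x₂) ∨ (u = x₃ ∧ v = x₄ ∨ u = x₄ ∧ v = x₃) := by
      have hi : (u = x₁ ∨ v = x₁) ∨ (u = x₂ ∨ v = x₂) ∨ (u = x₃ ∨ v = x₃) := by
        fin_cases i
        · simp at h0
        · exact .inl h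
        · exact .inr (.inl h)
        · exact .inr (.inr h)
        · simp at h4
      rcases hi with (rfl | rfl) | (rfl | rfl) | (rfl | rfl)
      · rcases (hout₁ v).1 huv with rfl | rfl <;> simp
      · rcases (hin₁ u).1 huv with rfl | rfl <;> simp
      · rcases (hout₂ v).1 huv with rfl | rfl <;> simp
      · rcases (hin₂ u).1 huv with rfl | rfl <;> simp
      · rcases (hout₃ v).1 huv with rfl | rfl <;> simp
      · rcases (hin₃ u).1 huv with rfl | rfl <;> simp
    rcases hex with h | h | h | h
    · exact ⟨0, h⟩
    · exact ⟨1, h⟩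
    · exact ⟨2, h⟩
    · exact ⟨3, h⟩
  · rintro ⟨i, h⟩
    fin_cases i
    · rcases h with ⟨hu, hv⟩ | ⟨hu, hv⟩
      · replace hu : u = x₀ := hu
        replace hv : v = x₁ := hv
        exact ⟨hv ▸ (hin₁ u).2 (.inl hu), 1, by norm_num, by norm_num, .inr hv⟩
      · replace hu : u = x₁ := hu
        replace hv : v = x₀ := hv
        exact ⟨hu ▸ (hout₁ v).2 (.inl hv), 1, by norm_num, by norm_num, .inl hu⟩
    · rcases h with ⟨hu, hv⟩ | ⟨hu, hv⟩
      · replace hu : u = x₁ := hu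
        replace hv : v = x₂ := hv
        exact ⟨hv ▸ (hin₂ u).2 (.inl hu), 2, by norm_num, by norm_num, .inr hv⟩
      · replace hu : u = x₂ := hu
        replace hv : v = x₁ := hv
        exact ⟨hu ▸ (hout₂ v).2 (.inl hv), 2, by norm_num, by norm_num, .inl hu⟩
    · rcases h with ⟨hu, hv⟩ | ⟨hu, hv⟩
      · replace hu : u = x₂ := hu
        replace hv : v = x₃ := hv
        exact ⟨hv ▸ (hin₃ u).2 (.inl hu), 3, by norm_num, by norm_num, .inr hv⟩
      · replace hu : u = x₃ := hu
        replace hv : v = x₂ := hv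
        exact ⟨hu ▸ (hout₃ v).2 (.inl hv), 3, by norm_num, by norm_num, .inl hu⟩
    · rcases h with ⟨hu, hv⟩ | ⟨hu, hv⟩
      · replace hu : u = x₃ := hu
        replace hv : v = x₄ := hv
        exact ⟨hu ▸ (hout₃ v).2 (.inr hv), 3, by norm_num, by norm_num, .inl hu⟩
      · replace hu : u = x₄ := hu
        replace hv : v = x₃ := hv
        exact ⟨hv ▸ (hin₃ u).2 (.inr hu), 3, by norm_num, by norm_num, .inr hv⟩

variable (D) in
/-- A vertex is special if it is the root, an outneighbour of the root, a vertex of indegree at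
least three, or the head of an arc which is not in a 2-cycle. -/
def IsSpecial (v : V) : Prop :=
  v = D.root ∨ D.Adj D.root v ∨
    (∃ x y z, D.Adj x v ∧ D.Adj y v ∧ D.Adj z v ∧ x ≠ y ∧ x ≠ z ∧ y ≠ z) ∨
    (v ≠ D.root ∧ ¬ D.Adj D.root v ∧ ∃ u, D.Adj u v ∧ ¬ D.Adj v u)

theorem adj_symm_of_not_isSpecial {v : V} (hv : ¬ D.IsSpecial v) {u : V} (h : D.Adj u v) :
    D.Adj v u := by
  by_contra hc
  simp only [IsSpecial, not_or] at hv
  exact hv.2.2.2 ⟨hv.1, hv.2.1, u, h, hc⟩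

theorem IsReduced.exists_inNbrs_of_not_isSpecial [Fintype V] (hD : D.IsReduced) {v : V}
    (hv : ¬ D.IsSpecial v) : ∃ p q, p ≠ q ∧ ∀ u, D.Adj u v ↔ u = p ∨ u = q := by
  classical
  have hv' := hv
  simp only [IsSpecial, not_or] at hv
  obtain ⟨p, q, hpq, -, -, ⟨u, hu, hpu⟩, u', hu', hqu⟩ := hD.exists_two_entries (U := {v})
    (Finset.singleton_nonempty v) (by simpa using ⟨hv.1, hv.2.1⟩)
  rw [Finset.mem_singleton] at hu hu'
  subst hu hu'
  refine ⟨p, q, hpq, fun w => ⟨fun hw => ?_, ?_⟩⟩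
  · by_contra! hc
    exact hv.2.2.1 ⟨p, q, w, hpu, hqu, hw, hpq, hc.1.symm, hc.2.symm⟩
  · rintro (rfl | rfl) <;> assumption

/-- Every vertex which is not special is equal or adjacent to a vertex which is not special and has
a special outneighbour. -/
theorem IsReduced.exists_near_special [Fintype V] (hD : D.IsReduced) {x : V}
    (hx : ¬ D.IsSpecial x) :
    ∃ y, ¬ D.IsSpecial y ∧ (∃ s, D.IsSpecial s ∧ D.Adj y s) ∧ (x = y ∨ D.Adj x y) := by
  classical
  -- Otherwise `x`, its two neighbours `p`, `q` and everything these point to are not special, so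
  -- all arcs at `p`, `x`, `q` are in 2-cycles. Two entries into `{p, x, q}` make the outer
  -- neighbours distinct, giving a bipath of length 4.
  by_contra! hc
  have hout : ∀ y, ¬ D.IsSpecial y → (x = y ∨ D.Adj x y) → ∀ v, D.Adj y v → ¬ D.IsSpecial v :=
    fun y hy hxy v hyv hv => hxy.elim (hc y hy ⟨v, hv, hyv⟩).1 (hc y hy ⟨v, hv, hyv⟩).2
  have hadj : ∀ y, ¬ D.IsSpecial y → (x = y ∨ D.Adj x y) → ∀ v, D.Adj y v ↔ D.Adj v y :=
    fun y hy hxy v => ⟨fun h => adj_symm_of_not_isSpecial (hout y hy hxy v h) h,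
      adj_symm_of_not_isSpecial hy⟩
  obtain ⟨p, q, hpq, hxin⟩ := hD.exists_inNbrs_of_not_isSpecial hx
  have hxout : ∀ u, D.Adj x u ↔ u = p ∨ u = q := fun u => (hadj x hx (.inl rfl) u).trans (hxin u)
  have hxp := (hxout p).2 (.inl rfl)
  have hxq := (hxout q).2 (.inr rfl)
  have hp := hout x hx (.inl rfl) p hxp
  have hq := hout x hx (.inl rfl) q hxq
  have other : ∀ y, ¬ D.IsSpecial y → D.Adj x y → ∃ y', ∀ u, D.Adj u y ↔ u = y' ∨ u = x := by
    intro y hy hxy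
    obtain ⟨a, b, -, hab⟩ := hD.exists_inNbrs_of_not_isSpecial hy
    rcases (hab x).1 hxy with rfl | rfl
    · exact ⟨b, fun u => (hab u).trans or_comm⟩
    · exact ⟨a, hab⟩
  obtain ⟨p', hpin⟩ := other p hp hxp
  obtain ⟨q', hqin⟩ := other q hq hxq
  obtain ⟨y, y', hne, hy, hy', ⟨u, hu, hyu⟩, u', hu', hyu'⟩ := hD.exists_two_entries
    (U := {p, x, q}) ⟨x, by simp⟩ (by
      have : ∀ v, ¬ D.IsSpecial v → v ≠ D.root ∧ ¬ D.Adj D.root v := fun v hv => by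
        simp only [IsSpecial, not_or] at hv
        exact ⟨hv.1, hv.2.1⟩
      simp only [Finset.mem_insert, Finset.mem_singleton]
      rintro v (rfl | rfl | rfl)
      exacts [this _ hp, this _ hx, this _ hq])
  have hent : ∀ w ∉ ({p, x, q} : Finset V), ∀ v ∈ ({p, x, q} : Finset V), D.Adj w v →
      w = p' ∨ w = q' := by
    intro w hw v hv hwv
    simp only [Finset.mem_insert, Finset.mem_singleton, not_or] at hw hv
    rcases hv with rfl | rfl | rfl
    · exact .inl (((hpin w).1 hwv).resolve_right hw.2.1)
    · exact (((hxin w).1 hwv).elim hw.1 hw.2.2).elim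
    · exact .inr (((hqin w).1 hwv).resolve_right hw.2.1)
  have hpq' : p' ∉ ({p, x, q} : Finset V) ∧ q' ∉ ({p, x, q} : Finset V) ∧ p' ≠ q' := by
    rcases hent y hy u hu hyu with rfl | rfl <;> rcases hent y' hy' u' hu' hyu' with rfl | rfl
    · exact absurd rfl hne
    · exact ⟨hy, hy', hne⟩
    · exact ⟨hy', hy, hne.symm⟩
    · exact absurd rfl hne
  simp only [Finset.mem_insert, Finset.mem_singleton, not_or] at hpq'
  obtain ⟨⟨h1, h2, h3⟩, ⟨h4, h5, h6⟩, h7⟩ := hpq'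
  have hpx : p ≠ x := fun h => D.loopless x (h ▸ hxp)
  have hqx : q ≠ x := fun h => D.loopless x (h ▸ hxq)
  refine hD.2.2.1 ⟨_, isBipath_four (x₀ := p') (x₁ := p) (x₂ := x) (x₃ := q) (x₄ := q') ?_ hpin
    (fun u => (hadj p hp (.inr hxp) u).trans (hpin u)) hxin hxout
    (fun u => (hqin u).trans or_comm)
    (fun u => (hadj q hq (.inr hxq) u).trans ((hqin u).trans or_comm))⟩
  simp only [List.nodup_cons, List.mem_cons, List.not_mem_nil, or_false, not_or, not_false_eq_true,
    List.nodup_nil, and_true]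
  exact ⟨⟨h1, h2, h3, h7⟩, ⟨hpx, hpq, Ne.symm h4⟩, ⟨hqx.symm, Ne.symm h5⟩, Ne.symm h6⟩

theorem IsReduced.card_lt [Fintype V] (hD : D.IsReduced) {k : ℕ}
    (hk : ∀ T, D.IsOutbranching T → (leaves T).ncard < k) :
    (Fintype.card V : ℤ) < (3 * (k : ℤ) - 2) * (30 * (k : ℤ) - 2) := by
  classical
  obtain ⟨T₀, hT₀, -⟩ := D.exists_outbranching_of_reachable D.Adj (fun _ _ h => h) hD.reachable
  -- Some outbranching exists, so `k = 0` is impossible.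
  obtain ⟨j, rfl⟩ : ∃ j, k = j + 1 := Nat.exists_eq_add_one.2 ((Nat.zero_le _).trans_lt (hk T₀ hT₀))
  have hm : ∀ T, D.IsOutbranching T → 3 * (leaves T).ncard ≤ 3 * j := fun T hT => by
    have := hk T hT
    omega
  set O := Finset.univ.filter (D.Adj D.root) with hO
  have hO' : ∀ v ∈ O, D.Adj D.root v := fun v hv => (Finset.mem_filter.1 hv).2
  set S := Finset.univ.filter D.IsSpecial with hS
  -- With `m = 3 * j`: at most `6 * j - 4 * O.card` vertices of indegree at least three, `24 * j -
  -- 16 * O.card` heads of arcs outside 2-cycles, `O.card` outneighbours of the root, and the root.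
  have hScard : S.card ≤ 30 * j + 1 := by
    have h3 := hD.card_three_le (S := Finset.univ.filter fun v => ∃ x y z, D.Adj x v ∧ D.Adj y v ∧
      D.Adj z v ∧ x ≠ y ∧ x ≠ z ∧ y ≠ z) hO' (fun v hv => (Finset.mem_filter.1 hv).2) hm
    have hn := hD.card_nice_le (S := Finset.univ.filter fun v => v ≠ D.root ∧ ¬ D.Adj D.root v ∧
      ∃ u, D.Adj u v ∧ ¬ D.Adj v u) hO' (fun v hv => (Finset.mem_filter.1 hv).2) hm
    have hr : (Finset.univ.filter fun v => v = D.root).card ≤ 1 := by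
      rw [Finset.filter_eq' Finset.univ D.root]
      simp
    have hsplit : S = Finset.univ.filter (fun v => v = D.root) ∪ (O ∪
        ((Finset.univ.filter fun v => ∃ x y z, D.Adj x v ∧ D.Adj y v ∧ D.Adj z v ∧
          x ≠ y ∧ x ≠ z ∧ y ≠ z) ∪
        Finset.univ.filter fun v => v ≠ D.root ∧ ¬ D.Adj D.root v ∧
          ∃ u, D.Adj u v ∧ ¬ D.Adj v u)) := by
      ext v
      simp only [hS, hO, Finset.mem_union, Finset.mem_filter, Finset.mem_univ, true_and, IsSpecial]
    have h5 := (congrArg Finset.card hsplit).le.trans (Finset.card_union_le _ _)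
    have h6 := h5.trans (Nat.add_le_add hr ((Finset.card_union_le _ _).trans
      (Nat.add_le_add_left (Finset.card_union_le _ _) _)))
    omega
  let N : V → Finset V := fun s => Finset.univ.filter fun u => D.Adj u s
  have hN : ∀ s, (N s).card ≤ j := by
    intro s
    obtain ⟨T, hT, hle⟩ := hD.exists_outbranching_inNbrs s
    have h1 : D.inNbrs s = (N s : Set V) := by
      ext u
      simp [N, inNbrs]
    rw [h1, Set.ncard_coe_finset] at hle
    have := hk T hT
    omega
  set M := Finset.univ.filter fun y => ¬ D.IsSpecial y ∧ ∃ s, D.IsSpecial s ∧ D.Adj y s with hM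
  have hMcard : M.card ≤ S.card * j := by
    refine (Finset.card_le_card ?_).trans (Finset.card_biUnion_le_card_mul S N j fun s _ => hN s)
    intro y hy
    obtain ⟨-, -, s, hs, hys⟩ := Finset.mem_filter.1 hy
    exact Finset.mem_biUnion.2 ⟨s, by simpa [hS] using hs, by simpa [N] using hys⟩
  -- Each vertex outside `S` is some `y` in `M` or one of its two in-neighbours.
  have hScompl : Sᶜ.card ≤ M.card * 3 := by
    refine (Finset.card_le_card ?_).trans
      (Finset.card_biUnion_le_card_mul M (fun y => insert y (N y)) 3 fun y hy => ?_)
    · intro x hx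
      have hx' : ¬ D.IsSpecial x := by simpa [hS] using hx
      obtain ⟨y, hy, hs, hxy⟩ := hD.exists_near_special hx'
      refine Finset.mem_biUnion.2 ⟨y, Finset.mem_filter.2 ⟨Finset.mem_univ _, hy, hs⟩, ?_⟩
      rcases hxy with rfl | hxy
      · exact Finset.mem_insert_self _ _
      · exact Finset.mem_insert_of_mem (by simpa [N] using hxy)
    · obtain ⟨p, q, -, hpq⟩ := hD.exists_inNbrs_of_not_isSpecial (Finset.mem_filter.1 hy).2.1
      have : N y ⊆ {p, q} := fun u hu => by
        have hu' : D.Adj u y := by simpa [N] using hu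
        simpa using (hpq u).1 hu'
      have h1 := (Finset.card_le_card this).trans Finset.card_le_two
      have h2 := Finset.card_insert_le y (N y)
      omega
  have hV := Finset.card_compl_add_card S
  have hfin : Fintype.card V ≤ (30 * j + 1) * (3 * j + 1) := by
    calc Fintype.card V ≤ S.card * j * 3 + S.card := by
          have := Nat.mul_le_mul_right 3 hMcard
          omega
      _ = S.card * (3 * j + 1) := by ring
      _ ≤ _ := Nat.mul_le_mul_right _ hScard
  have hfin' : (Fintype.card V : ℤ) ≤ (30 * j + 1) * (3 * j + 1) := by exact_mod_cast hfin
  push_cast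
  nlinarith [Int.natCast_nonneg j]

end RootedDigraph

theorem theorem3 {V : Type*} [Fintype V] (D : RootedDigraph V) (hD : D.IsReduced) (k : ℕ)
    (hcard : (3 * (k : ℤ) - 2) * (30 * (k : ℤ) - 2) ≤ (Fintype.card V : ℤ)) :
    ∃ T : Digraph V, D.IsOutbranching T ∧ k ≤ (RootedDigraph.leaves T).ncard := by
  by_contra! hc
  exact absurd hcard (not_le.2 (hD.card_lt hc))
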